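/- Let $\lambda_1,\lambda_2>0$. For $\xi\in\mathbb R^2$ put $$l_{11}(\xi)=-\lambda_1|2\pi\xi|^2-1,\qquad l_{21}(\xi)=\lambda_1\lambda_2-1,\qquad l_{22}(\xi)=-|2\pi\xi|^2-\lambda_2,$$ where $|\cdot|$ is the Euclidean norm; write $|x|_1=|x_1|+|x_2|$. The functions $\frac1{l_{11}}$, $\frac1{l_{22}}$ and $\frac{l_{21}}{l_{11}l_{22}}$ belong to $L^2(\mathbb R^2)$. Let $\mathcal F^{-1}$ be the inverse on $L^2(\mathbb R^2)$ of the Fourier transform $\mathcal F(u)(\xi)=\int_{\mathbb R^2}u(x)e^{-2\pi i x\cdot\xi}\,dx$, and set $$f_{11}=\mathcal F^{-1}\Big(\frac1{l_{11}}\Big),\qquad f_{22}=\mathcal F^{-1}\Big(\frac1{l_{22}}\Big),\qquad f_3=\mathcal F^{-1}\Big(\frac{l_{21}}{l_{11}l_{22}}\Big).$$ Let $a_1=\sqrt{1/\lambda_1}$, $a_2=\sqrt{\lambda_2}$ and $$C_0(f_{11})=\max\Big\{2a_1^2e^{5/4}\Big(\frac2{a_1}\Big)^{1/4},\ a_1^2\sqrt{\frac{\pi}{2\sqrt{a_1}}}\Big\},\qquad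 C_0(f_{22})=\max\Big\{2e^{5/4}\Big(\frac2{a_2}\Big)^{1/4},\ \sqrt{\frac{\pi}{2\sqrt{a_2}}}\Big\}.$$ Then each of $f_{11},f_{22},f_3$ has a (necessarily unique) representative that is continuous on $\mathbb R^2\setminus\{0\}$, and these representatives satisfy, for all $x\in\mathbb R^2\setminus\{0\}$, $$|f_{11}(x)|\le C_0(f_{11})\frac{e^{-a_1|x|}}{|x|_1^{1/4}},\qquad |f_{22}(x)|\le C_0(f_{22})\frac{e^{-a_2|x|}}{|x|_1^{1/4}},$$ $$|f_3(x)|\le\begin{cases}C_0(f_{22})\dfrac{e^{-a_2|x|}}{|x|^{1/4}}&\text{if }\frac1{\lambda_1}\ge\lambda_2,\\[2mm]\dfrac1{a_1^2}\,C_0(f_{11})\dfrac{e^{-a_1|x|}}{|x|^{1/4}}&\text{if }\frac1{\lambda_1}\le\lambda_2.\end{cases}$$ (Since $|x|\le|x|_1$, the first two bounds also hold with $|x|^{1/4}$ in place of $|x|_1^{1/4}$.) -/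

import Mathlib

open MeasureTheory FourierTransform

noncomputable section

/-- The plane `ℝ²` with its Euclidean norm. -/
abbrev Plane : Type := EuclideanSpace ℝ (Fin 2)

/-- The `ℓ¹` norm `|x|₁ = |x₁| + |x₂|` on the plane. -/
def normOne (x : Plane) : ℝ := |x 0| + |x 1|

/-- The entry `l₁₁(ξ) = -λ₁ |2πξ|² - 1` of the symbol of the linear part. -/
def l11 (lam1 : ℝ) (ξ : Plane) : ℝ := -lam1 * ‖(2 * Real.pi) • ξ‖ ^ 2 - 1

/-- The (constant) entry `l₂₁(ξ) = λ₂ λ₁ - 1`. -/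
def l21 (lam1 lam2 : ℝ) (_ξ : Plane) : ℝ := lam2 * lam1 - 1

/-- The entry `l₂₂(ξ) = -|2πξ|² - λ₂`. -/
def l22 (lam2 : ℝ) (ξ : Plane) : ℝ := -‖(2 * Real.pi) • ξ‖ ^ 2 - lam2

/-- The constant `a₁ = √(1/λ₁)`. -/
def a1 (lam1 : ℝ) : ℝ := Real.sqrt (1 / lam1)

/-- The constant `a₂ = √λ₂`. -/
def a2 (lam2 : ℝ) : ℝ := Real.sqrt lam2

/-- The constant `C₀(f₁₁)`. -/
def C0f11 (lam1 : ℝ) : ℝ :=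
  max (a1 lam1 ^ 2 * (2 * Real.exp (5 / 4)) * (2 / a1 lam1) ^ (1 / 4 : ℝ))
    (a1 lam1 ^ 2 * Real.sqrt (Real.pi / (2 * Real.sqrt (a1 lam1))))

/-- The constant `C₀(f₂₂)`. -/
def C0f22 (lam2 : ℝ) : ℝ :=
  max (2 * Real.exp (5 / 4) * (2 / a2 lam2) ^ (1 / 4 : ℝ))
    (Real.sqrt (Real.pi / (2 * Real.sqrt (a2 lam2))))

lemma memLp_one_add_norm_sq_inv :
    MemLp (fun ξ : Plane => (1 + ‖ξ‖ ^ 2)⁻¹) 2 volume := by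
  have hm : Measurable (fun ξ : Plane => (1 + ‖ξ‖ ^ 2)⁻¹) := by fun_prop
  rw [memLp_two_iff_integrable_sq hm.aestronglyMeasurable]
  have h := integrable_rpow_neg_one_add_norm_sq (E := Plane) (μ := volume) (r := 4)
    (by simp; norm_num)
  refine h.congr (Filter.Eventually.of_forall fun ξ => ?_)
  have hp : (0 : ℝ) ≤ 1 + ‖ξ‖ ^ 2 := by positivity
  have e : (-4 / 2 : ℝ) = -((2 : ℕ) : ℝ) := by norm_num
  simp only [e]
  rw [Real.rpow_neg hp, Real.rpow_natCast, inv_pow]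

lemma norm_two_pi_smul_sq (ξ : Plane) : ‖ξ‖ ^ 2 ≤ ‖(2 * Real.pi) • ξ‖ ^ 2 := by
  have h : (1 : ℝ) ≤ |2 * Real.pi| := by
    rw [abs_of_pos Real.two_pi_pos]; linarith [Real.pi_gt_three]
  rw [norm_smul, Real.norm_eq_abs, mul_pow]
  nlinarith [sq_nonneg ‖ξ‖, mul_self_nonneg (|2 * Real.pi| - 1)]

lemma memLp_inv_symbol {c d : ℝ} (hc : 0 < c) (hd : 0 < d) (k : ℝ) :
    MemLp (fun ξ : Plane => ((k / (-c * ‖(2 * Real.pi) • ξ‖ ^ 2 - d) : ℝ) : ℂ)) 2 volume := by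
  refine memLp_one_add_norm_sq_inv.of_le_mul (c := |k| / min c d)
    (by apply Measurable.aestronglyMeasurable; fun_prop)
    (Filter.Eventually.of_forall fun ξ => ?_)
  have hmin : 0 < min c d := lt_min hc hd
  have h1 := norm_two_pi_smul_sq ξ
  have hle : min c d * (1 + ‖ξ‖ ^ 2) ≤ c * ‖(2 * Real.pi) • ξ‖ ^ 2 + d := by
    nlinarith [min_le_left c d, min_le_right c d, sq_nonneg ‖ξ‖]
  have hp : 0 < min c d * (1 + ‖ξ‖ ^ 2) := by positivity
  have e : -c * ‖(2 * Real.pi) • ξ‖ ^ 2 - d = -(c * ‖(2 * Real.pi) • ξ‖ ^ 2 + d) := by ring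
  rw [Complex.norm_real, Real.norm_eq_abs, e, abs_div, abs_neg, abs_of_pos (hp.trans_le hle),
    Real.norm_eq_abs, abs_of_pos (by positivity : (0 : ℝ) < (1 + ‖ξ‖ ^ 2)⁻¹),
    ← div_eq_mul_inv, div_div]
  gcongr

lemma memLp_inv_l11 {lam1 : ℝ} (h1 : 0 < lam1) :
    MemLp (fun ξ : Plane => ((1 / l11 lam1 ξ : ℝ) : ℂ)) 2 volume :=
  memLp_inv_symbol h1 one_pos 1

lemma memLp_inv_l22 {lam2 : ℝ} (h2 : 0 < lam2) :
    MemLp (fun ξ : Plane => ((1 / l22 lam2 ξ : ℝ) : ℂ)) 2 volume := by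
  have h := memLp_inv_symbol one_pos h2 1
  simpa only [l22, neg_mul, one_mul] using h

lemma memLp_l21_div {lam1 lam2 : ℝ} (h1 : 0 < lam1) (h2 : 0 < lam2) :
    MemLp (fun ξ : Plane => ((l21 lam1 lam2 ξ / (l11 lam1 ξ * l22 lam2 ξ) : ℝ) : ℂ))
      2 volume := by
  refine (memLp_inv_l22 h2).of_le_mul (c := |lam2 * lam1 - 1|)
    (by
      apply Measurable.aestronglyMeasurable
      unfold l21 l11 l22
      fun_prop)
    (Filter.Eventually.of_forall fun ξ => ?_)
  have hl : 1 ≤ |l11 lam1 ξ| := by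
    have : 0 ≤ lam1 * ‖(2 * Real.pi) • ξ‖ ^ 2 := by positivity
    rw [l11, abs_of_neg (by linarith)]
    linarith
  simp only [Complex.norm_real, Real.norm_eq_abs, abs_div, abs_mul, abs_one, l21]
  rw [← div_div, div_eq_mul_one_div _ |l22 lam2 ξ|]
  gcongr
  exact div_le_self (abs_nonneg _) hl

/-- `f₁₁ = ℱ⁻¹(1/l₁₁)`, the inverse Fourier transform (of kernel `e^{2πi x·ξ}`) on `L²(ℝ²)`. -/
def f11 {lam1 : ℝ} (h1 : 0 < lam1) : Lp ℂ 2 (volume : Measure Plane) :=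
  𝓕⁻ (memLp_inv_l11 h1).toLp

/-- `f₂₂ = ℱ⁻¹(1/l₂₂)` in `L²(ℝ²)`. -/
def f22 {lam2 : ℝ} (h2 : 0 < lam2) : Lp ℂ 2 (volume : Measure Plane) :=
  𝓕⁻ (memLp_inv_l22 h2).toLp

/-- `f₃ = ℱ⁻¹(l₂₁/(l₁₁ l₂₂))` in `L²(ℝ²)`. -/
def f3 {lam1 lam2 : ℝ} (h1 : 0 < lam1) (h2 : 0 < lam2) : Lp ℂ 2 (volume : Measure Plane) :=
  𝓕⁻ (memLp_l21_div h1 h2).toLp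

/-- `g` is the pointwise version of the `L²` class `f` on `ℝ² ∖ {0}`: it represents `f` almost
everywhere and is continuous away from the origin. The values `g x` with `x ≠ 0` are then
uniquely determined by `f`. -/
def IsContinuousVersion (f : Lp ℂ 2 (volume : Measure Plane)) (g : Plane → ℂ) : Prop :=
  f =ᵐ[volume] g ∧ ContinuousOn g {0}ᶜ

end

/-! With s = |2πξ|², the symbols are -1/l₁₁ = a₁²/(a₁² + s) and -1/l₂₂ = 1/(a₂² + s), and partial
fractions give l₂₁/(l₁₁l₂₂) = 1/(a₁² + s) - 1/(a₂² + s). If K_a is the fundamental solution of a² -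
Δ (`screenedKernel`), then f₁₁ = -a₁²K_{a₁}, f₂₂ = -K_{a₂} and f₃ = K_{a₁} - K_{a₂}. K_a is
integrable with the expected transform (`fourier_screenedKernel`), and `fourierInv_toLp_ae_eq`
carries this to the inverse transform on L².

Away from 0, 4πK_a(x) = ∫ exp(-a|x| cosh u) du, which yields continuity, decay in a, and K_a(x) ≤
e^{-a|x|}(a|x|)^{-1/4} (`screenedKernel_le`). As the kernels are nonnegative and decrease in a, |f₃|
is at most the kernel with the smaller parameter. -/

/-- If `h ∈ L²` is pointwise the Fourier transform of an integrable function `G`, then `G`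
represents the inverse Fourier transform of `h` in `L²`. -/
lemma fourierInv_toLp_ae_eq {h G : Plane → ℂ} (hh : MemLp h 2 volume) (hG : Integrable G)
    (hGh : ∀ ξ, 𝓕 G ξ = h ξ) :
    (𝓕⁻ hh.toLp : Lp ℂ 2 (volume : Measure Plane)) =ᵐ[volume] G := by
  refine ae_eq_of_integral_contDiff_smul_eq
    ((Lp.memLp _).locallyIntegrable (by norm_num)) hG.locallyIntegrable fun φ hφ hφc => ?_
  have hS₁ : HasCompactSupport (Complex.ofRealCLM ∘ φ) := hφc.comp_left rfl
  have hS₂ : ContDiff ℝ (⊤ : ℕ∞) (Complex.ofRealCLM ∘ φ) := by fun_prop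
  set S := hS₁.toSchwartzMap hS₂ with hS
  let T : SchwartzMap Plane ℂ := 𝓕⁻ S
  have hSφ : ∀ x, S x = (φ x : ℂ) := fun x => by simp [hS]
  -- Both sides are tested against φ: distributional duality moves 𝓕⁻ from `h` onto the test
  -- function, and Fubini for the integrable `G` moves 𝓕 back.
  have key : ∫ x, S x • (𝓕⁻ hh.toLp : Lp ℂ 2 (volume : Measure Plane)) x
      = ∫ x, T x • (hh.toLp : Lp ℂ 2 (volume : Measure Plane)) x := by
    rw [← Lp.toTemperedDistribution_apply, ← Lp.fourierInv_toTemperedDistribution_eq,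
      TemperedDistribution.fourierInv_apply, Lp.toTemperedDistribution_apply]
  have flip : ∫ x, 𝓕 G x • T x = ∫ x, G x • (𝓕 (⇑T) : Plane → ℂ) x := by
    have := VectorFourier.integral_fourierIntegral_smul_eq_flip (L := innerₗ Plane)
      (μ := volume) (ν := volume) Real.continuous_fourierChar continuous_inner hG
      T.integrable
    rwa [flip_innerₗ] at this
  calc ∫ x, φ x • (𝓕⁻ hh.toLp : Lp ℂ 2 (volume : Measure Plane)) x
      = ∫ x, S x • (𝓕⁻ hh.toLp : Lp ℂ 2 (volume : Measure Plane)) x := by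
        simp only [hSφ, Complex.real_smul, smul_eq_mul]
    _ = ∫ x, 𝓕 G x • T x := by
        rw [key]
        refine integral_congr_ae ?_
        filter_upwards [hh.coeFn_toLp] with x hx
        rw [hx, hGh, smul_eq_mul, smul_eq_mul, mul_comm]
    _ = ∫ x, φ x • G x := by
        rw [flip, ← SchwartzMap.fourier_coe, fourier_fourierInv_eq]
        simp only [hSφ, Complex.real_smul, smul_eq_mul, mul_comm]

/-! ### Bounds for ∫ exp(-z cosh u) du -/

/-- Two terms of a nonnegative Taylor series. Keeping the quartic term rather than the quadratic one
produces the power z^{-1/4} after scaling. -/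
lemma one_add_pow_four_le_cosh (u : ℝ) : 1 + u ^ 4 / 24 ≤ Real.cosh u := by
  have h := sum_le_hasSum {0, 2} (fun n _ => by
    rw [pow_mul]; positivity) (Real.hasSum_cosh u)
  simpa [Nat.factorial] using h

lemma integrable_exp_neg_mul_pow_four {b : ℝ} (hb : 0 < b) :
    Integrable fun u : ℝ => Real.exp (-b * u ^ 4) := by
  refine ((integrable_exp_neg_mul_sq hb).const_mul (Real.exp b)).mono'
    (by fun_prop) (.of_forall fun u => ?_)
  rw [Real.norm_eq_abs, Real.abs_exp, ← Real.exp_add, Real.exp_le_exp]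
  -- The Gaussian majorant rests on u² ≤ 1 + u⁴.
  nlinarith [mul_nonneg hb.le (sq_nonneg (u ^ 2 - 1)), mul_nonneg hb.le (sq_nonneg u),
    mul_nonneg hb.le (sq_nonneg (u ^ 2))]

lemma integral_exp_neg_mul_pow_four_le {b : ℝ} (hb : 0 < b) :
    ∫ u : ℝ, Real.exp (-b * u ^ 4) ≤ 2 * b ^ (-(1 / 4) : ℝ) := by
  have habs : ∀ u : ℝ, Real.exp (-b * u ^ 4) = Real.exp (-b * |u| ^ (4 : ℝ)) := fun u => by
    rw [show (4 : ℝ) = ((4 : ℕ) : ℝ) by norm_num, Real.rpow_natCast, Even.pow_abs (by decide)]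
  -- The integral is 2Γ(5/4)b^{-1/4}; Γ is convex and Γ(1) = Γ(2) = 1.
  have hΓ : Real.Gamma (1 / 4 + 1) ≤ 1 := by
    have := Real.convexOn_Gamma.2 (show (1 : ℝ) ∈ Set.Ioi 0 by simp)
      (show (2 : ℝ) ∈ Set.Ioi 0 by simp) (show (0 : ℝ) ≤ 3 / 4 by norm_num)
      (show (0 : ℝ) ≤ 1 / 4 by norm_num) (by norm_num)
    norm_num [Real.Gamma_one, Real.Gamma_two] at this
    norm_num
    exact this
  simp_rw [habs]
  rw [integral_comp_abs (f := fun u => Real.exp (-b * u ^ (4 : ℝ))),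
    integral_exp_neg_mul_rpow (by norm_num) hb, neg_div]
  have : (0 : ℝ) ≤ b ^ (-(1 / 4) : ℝ) := by positivity
  nlinarith

lemma exp_neg_mul_cosh_le {z : ℝ} (hz : 0 ≤ z) (u : ℝ) :
    Real.exp (-(z * Real.cosh u)) ≤ Real.exp (-z) * Real.exp (-(z / 24) * u ^ 4) := by
  rw [← Real.exp_add, Real.exp_le_exp]
  nlinarith [one_add_pow_four_le_cosh u]

lemma integrable_exp_neg_mul_cosh {z : ℝ} (hz : 0 < z) :
    Integrable fun u : ℝ => Real.exp (-(z * Real.cosh u)) := by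
  refine ((integrable_exp_neg_mul_pow_four (div_pos hz (by norm_num : (0 : ℝ) < 24))).const_mul
    (Real.exp (-z))).mono' ?_ (.of_forall fun u => ?_)
  · exact (Real.continuous_exp.comp
      (continuous_const.mul Real.continuous_cosh).neg).aestronglyMeasurable
  · rw [Real.norm_eq_abs, Real.abs_exp]
    exact exp_neg_mul_cosh_le hz.le u

lemma integral_exp_neg_mul_cosh_le {z : ℝ} (hz : 0 < z) :
    ∫ u : ℝ, Real.exp (-(z * Real.cosh u)) ≤ 6 * Real.exp (-z) * z ^ (-(1 / 4) : ℝ) := by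
  have hz' : 0 < z / 24 := by positivity
  -- This is 24 ≤ 81 = 3⁴.
  have h24 : (z / 24) ^ (-(1 / 4) : ℝ) ≤ 3 * z ^ (-(1 / 4) : ℝ) := by
    have h3 : (3 : ℝ) = (81⁻¹ : ℝ) ^ (-(1 / 4) : ℝ) := by
      rw [show (81⁻¹ : ℝ) = 3 ^ (-4 : ℝ) by
        rw [Real.rpow_neg (by norm_num), show (4 : ℝ) = ((4 : ℕ) : ℝ) by norm_num,
          Real.rpow_natCast]; norm_num, ← Real.rpow_mul (by norm_num)]
      norm_num
    conv_rhs => rw [h3]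
    rw [← Real.mul_rpow (by norm_num) hz.le]
    refine Real.rpow_le_rpow_of_nonpos (by positivity) ?_ (by norm_num)
    linarith
  calc ∫ u : ℝ, Real.exp (-(z * Real.cosh u))
      ≤ ∫ u : ℝ, Real.exp (-z) * Real.exp (-(z / 24) * u ^ 4) :=
        integral_mono (integrable_exp_neg_mul_cosh hz)
          ((integrable_exp_neg_mul_pow_four hz').const_mul _) (exp_neg_mul_cosh_le hz.le)
    _ ≤ Real.exp (-z) * (2 * (3 * z ^ (-(1 / 4) : ℝ))) := by
        rw [integral_const_mul]
        have := integral_exp_neg_mul_pow_four_le hz'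
        gcongr
        linarith
    _ = _ := by ring

/-! ### The screened kernel: size, monotonicity, continuity -/

/-- The fundamental solution `x ↦ K₀(a|x|) / 2π` of `a² - Δ` on the plane, as a superposition of
heat kernels at the times `eᵘ`. -/
noncomputable def screenedKernel (a : ℝ) (x : Plane) : ℝ :=
  (4 * Real.pi)⁻¹ * ∫ u : ℝ, Real.exp (-(a ^ 2 * Real.exp u) - Real.exp (-u) / 4 * ‖x‖ ^ 2)

/-- Shifting u by log(r/2a) balances the two exponentials: both get the coefficient ar/2. -/
lemma exponent_add_log {a r : ℝ} (ha : 0 < a) (hr : 0 < r) (u : ℝ) :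
    -(a ^ 2 * Real.exp (u + Real.log (r / (2 * a))))
      - Real.exp (-(u + Real.log (r / (2 * a)))) / 4 * r ^ 2 = -(a * r * Real.cosh u) := by
  rw [neg_add, Real.exp_add, Real.exp_add, Real.exp_neg (Real.log _),
    Real.exp_log (by positivity), Real.cosh_eq]
  field_simp
  ring

lemma screenedKernel_eq {a : ℝ} (ha : 0 < a) {x : Plane} (hx : x ≠ 0) :
    screenedKernel a x =
      (4 * Real.pi)⁻¹ * ∫ u : ℝ, Real.exp (-(a * ‖x‖ * Real.cosh u)) := by
  rw [screenedKernel, ← integral_add_right_eq_self _ (Real.log (‖x‖ / (2 * a)))]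
  simp only [exponent_add_log ha (norm_pos_iff.2 hx)]

lemma screenedKernel_nonneg (a : ℝ) (x : Plane) : 0 ≤ screenedKernel a x :=
  mul_nonneg (by positivity) (integral_nonneg fun _ => (Real.exp_pos _).le)

lemma screenedKernel_anti {a b : ℝ} (ha : 0 < a) (hab : a ≤ b) {x : Plane} (hx : x ≠ 0) :
    screenedKernel b x ≤ screenedKernel a x := by
  have hx' := norm_pos_iff.2 hx
  rw [screenedKernel_eq ha hx, screenedKernel_eq (ha.trans_le hab) hx]
  refine mul_le_mul_of_nonneg_left (integral_mono
    (integrable_exp_neg_mul_cosh (mul_pos (ha.trans_le hab) hx'))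
    (integrable_exp_neg_mul_cosh (mul_pos ha hx')) fun u => ?_) (by positivity)
  have := (Real.cosh_pos u).le
  gcongr

lemma screenedKernel_le {a : ℝ} (ha : 0 < a) {x : Plane} (hx : x ≠ 0) :
    screenedKernel a x ≤ Real.exp (-(a * ‖x‖)) * (a * ‖x‖) ^ (-(1 / 4) : ℝ) := by
  have hz : 0 < a * ‖x‖ := mul_pos ha (norm_pos_iff.2 hx)
  rw [screenedKernel_eq ha hx]
  have hπ : (4 * Real.pi)⁻¹ ≤ 1 / 6 := by
    rw [inv_le_comm₀ (by positivity) (by norm_num)]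
    linarith [Real.pi_gt_three]
  calc _ ≤ 1 / 6 * (6 * Real.exp (-(a * ‖x‖)) * (a * ‖x‖) ^ (-(1 / 4) : ℝ)) := by
        have := integral_exp_neg_mul_cosh_le hz
        gcongr
    _ = _ := by ring

lemma continuousOn_screenedKernel {a : ℝ} (ha : 0 < a) :
    ContinuousOn (screenedKernel a) {0}ᶜ := by
  suffices h : ContinuousOn (fun x : Plane =>
      (4 * Real.pi)⁻¹ * ∫ u : ℝ, Real.exp (-(a * ‖x‖ * Real.cosh u))) {0}ᶜ from
    h.congr fun x hx => screenedKernel_eq ha hx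
  refine continuousOn_const.mul fun x hx => ContinuousAt.continuousWithinAt ?_
  have hx' : 0 < ‖x‖ := norm_pos_iff.2 hx
  refine continuousAt_of_dominated
    -- Near x one has |y| > |x|/2, so a single integrable majorant serves.
    (bound := fun u => Real.exp (-(a * (‖x‖ / 2) * Real.cosh u))) ?_ ?_
    (integrable_exp_neg_mul_cosh (by positivity)) ?_
  · refine .of_forall fun y => Continuous.aestronglyMeasurable ?_
    exact Real.continuous_exp.comp (continuous_const.mul Real.continuous_cosh).neg
  · filter_upwards [continuous_norm.continuousAt.eventually (lt_mem_nhds (half_lt_self hx'))]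
      with y hy
    refine .of_forall fun u => ?_
    have := (Real.cosh_pos u).le
    rw [Real.norm_eq_abs, Real.abs_exp]
    gcongr
  · exact .of_forall fun u => by fun_prop

/-! ### Integrability and Fourier transform of the kernel -/

lemma hasDerivAt_exp_neg_mul_exp {A : ℝ} (hA : 0 < A) (u : ℝ) :
    HasDerivAt (fun u => -(A⁻¹ * Real.exp (-(A * Real.exp u))))
      (Real.exp u * Real.exp (-(A * Real.exp u))) u := by
  refine HasDerivAt.congr_deriv
    ((((Real.hasDerivAt_exp u).const_mul A).neg.exp).const_mul A⁻¹).neg ?_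
  simp only [Pi.neg_apply, mul_neg, neg_neg]
  field_simp

lemma tendsto_atBot_exp_neg_mul_exp (A : ℝ) :
    Filter.Tendsto (fun u => -(A⁻¹ * Real.exp (-(A * Real.exp u)))) .atBot (nhds (-A⁻¹)) := by
  have : Filter.Tendsto (fun u : ℝ => -(A⁻¹ * Real.exp (-(A * Real.exp u)))) .atBot
      (nhds (-(A⁻¹ * Real.exp (-(A * 0))))) :=
    ((Real.continuous_exp.tendsto _).comp
      (Real.tendsto_exp_atBot.const_mul A).neg).const_mul A⁻¹ |>.neg
  simpa using this

lemma tendsto_atTop_exp_neg_mul_exp {A : ℝ} (hA : 0 < A) :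
    Filter.Tendsto (fun u => -(A⁻¹ * Real.exp (-(A * Real.exp u)))) .atTop (nhds 0) := by
  have : Filter.Tendsto (fun u : ℝ => -(A⁻¹ * Real.exp (-(A * Real.exp u)))) .atTop
      (nhds (-(A⁻¹ * 0))) :=
    (Real.tendsto_exp_neg_atTop_nhds_zero.comp
      (Real.tendsto_exp_atTop.const_mul_atTop hA)).const_mul A⁻¹ |>.neg
  simpa using this

lemma integrable_exp_mul_exp_neg_mul_exp {A : ℝ} (hA : 0 < A) :
    Integrable fun u => Real.exp u * Real.exp (-(A * Real.exp u)) := by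
  rw [← integrableOn_univ, ← Set.Iic_union_Ioi (a := (0 : ℝ)), integrableOn_union]
  constructor
  · refine Integrable.mono' (integrableOn_exp_Iic 0) (by fun_prop) (.of_forall fun u => ?_)
    rw [Real.norm_eq_abs, abs_of_pos (by positivity)]
    refine mul_le_of_le_one_right (Real.exp_pos _).le (Real.exp_le_one_iff.2 ?_)
    have := mul_pos hA (Real.exp_pos u)
    linarith
  · exact integrableOn_Ioi_deriv_of_nonneg' (fun u _ => hasDerivAt_exp_neg_mul_exp hA u)
      (fun u _ => by positivity) (tendsto_atTop_exp_neg_mul_exp hA)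

lemma integral_exp_mul_exp_neg_mul_exp {A : ℝ} (hA : 0 < A) :
    ∫ u, Real.exp u * Real.exp (-(A * Real.exp u)) = A⁻¹ := by
  rw [integral_of_hasDerivAt_of_tendsto (hasDerivAt_exp_neg_mul_exp hA)
    (integrable_exp_mul_exp_neg_mul_exp hA) (tendsto_atBot_exp_neg_mul_exp A)
    (tendsto_atTop_exp_neg_mul_exp hA)]
  ring

lemma integral_exp_neg_exp_mul_norm_sq (u : ℝ) :
    ∫ x : Plane, Real.exp (-(Real.exp (-u) / 4) * ‖x‖ ^ 2) = 4 * Real.pi * Real.exp u := by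
  rw [GaussianFourier.integral_rexp_neg_mul_sq_norm (by positivity)]
  simp only [finrank_euclideanSpace, Fintype.card_fin, Nat.cast_ofNat, div_self_eq_one₀.2, ne_eq,
    OfNat.ofNat_ne_zero, not_false_eq_true, Real.rpow_one, Real.exp_neg]
  field_simp

lemma integrable_exp_neg_mul_norm_sq {b : ℝ} (hb : 0 < b) :
    Integrable fun x : Plane => Real.exp (-b * ‖x‖ ^ 2) := by
  -- A non-integrable function has integral 0 by convention, while the Gaussian formula gives a
  -- positive value.
  by_contra h
  have h0 := integral_undef h
  rw [GaussianFourier.integral_rexp_neg_mul_sq_norm hb] at h0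
  have : 0 < (Real.pi / b) ^ (Module.finrank ℝ Plane / 2 : ℝ) := by positivity
  exact this.ne' h0

/-- By Tonelli, integrating in x first: each Gaussian has mass 4πeᵘ, and eᵘ exp(-a²eᵘ) is integrable
with an explicit primitive. -/
lemma integrable_screenedKernel_prod {a : ℝ} (ha : 0 < a) :
    Integrable (fun p : Plane × ℝ =>
      Real.exp (-(a ^ 2 * Real.exp p.2) - Real.exp (-p.2) / 4 * ‖p.1‖ ^ 2))
      (volume.prod volume) := by
  have hsplit : ∀ (x : Plane) (u : ℝ),
      Real.exp (-(a ^ 2 * Real.exp u) - Real.exp (-u) / 4 * ‖x‖ ^ 2) =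
      Real.exp (-(a ^ 2 * Real.exp u)) * Real.exp (-(Real.exp (-u) / 4) * ‖x‖ ^ 2) :=
    fun x u => by rw [← Real.exp_add]; ring_nf
  rw [integrable_prod_iff' (by fun_prop)]
  simp only [Real.norm_eq_abs, Real.abs_exp]
  simp only [hsplit, integral_const_mul, integral_exp_neg_exp_mul_norm_sq]
  refine ⟨.of_forall fun u =>
    (integrable_exp_neg_mul_norm_sq (by positivity)).const_mul _, ?_⟩
  refine ((integrable_exp_mul_exp_neg_mul_exp (pow_pos ha 2)).const_mul (4 * Real.pi)).congr
    (.of_forall fun u => ?_)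
  ring

lemma integrable_screenedKernel {a : ℝ} (ha : 0 < a) : Integrable (screenedKernel a) :=
  (integrable_screenedKernel_prod ha).integral_prod_left.const_mul _

lemma fourier_gaussian_plane (u : ℝ) (ξ : Plane) :
    𝓕 (fun x : Plane => ((Real.exp (-(Real.exp (-u) / 4) * ‖x‖ ^ 2) : ℝ) : ℂ)) ξ =
      ((4 * Real.pi * Real.exp u * Real.exp (-(‖(2 * Real.pi) • ξ‖ ^ 2 * Real.exp u)) : ℝ) : ℂ) := by
  have h := fourier_gaussian_innerProductSpace (V := Plane)
    (b := ((Real.exp (-u) / 4 : ℝ) : ℂ)) (by rw [Complex.ofReal_re]; positivity) ξ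
  have e : (Module.finrank ℝ Plane / 2 : ℂ) = 1 := by simp
  rw [e, Complex.cpow_one] at h
  convert h using 1
  · push_cast
    rfl
  · have hn : ‖(2 * Real.pi) • ξ‖ ^ 2 = 4 * Real.pi ^ 2 * ‖ξ‖ ^ 2 := by
      rw [norm_smul, mul_pow, Real.norm_eq_abs, sq_abs]; ring
    rw [hn, Complex.ofReal_mul, Complex.ofReal_exp (-_)]
    congr 1
    · rw [Real.exp_neg]; push_cast; field_simp
    · congr 1
      rw [Real.exp_neg]; push_cast; field_simp

/-- After Fubini, each Gaussian transform contributes exp(-|2πξ|²eᵘ), so a² is replaced by A = a² +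
|2πξ|² in the u-integral, whose value is A⁻¹. -/
lemma fourier_screenedKernel {a : ℝ} (ha : 0 < a) (ξ : Plane) :
    𝓕 (fun x => (screenedKernel a x : ℂ)) ξ =
      (((a ^ 2 + ‖(2 * Real.pi) • ξ‖ ^ 2)⁻¹ : ℝ) : ℂ) := by
  have hA : 0 < a ^ 2 + ‖(2 * Real.pi) • ξ‖ ^ 2 := by positivity
  let e : Plane → ℂ := fun x => (Real.fourierChar (-(inner ℝ x ξ)) : ℂ)
  have he : Continuous e := by
    unfold e
    exact continuous_subtype_val.comp (Real.continuous_fourierChar.comp (by fun_prop))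
  let F : Plane → ℝ → ℝ := fun x u =>
    Real.exp (-(a ^ 2 * Real.exp u) - Real.exp (-u) / 4 * ‖x‖ ^ 2)
  have hF : Integrable (Function.uncurry fun x u => e x * (F x u : ℂ))
      (volume.prod volume) := by
    refine (integrable_screenedKernel_prod ha).mono (by
      unfold F
      exact (Continuous.aestronglyMeasurable (by fun_prop))) (.of_forall fun p => ?_)
    simp only [Function.uncurry, e, F, norm_mul, Circle.norm_coe, one_mul, Complex.norm_real,
      le_refl]
  have inner_int : ∀ u, ∫ x, e x * (F x u : ℂ) = ((4 * Real.pi * (Real.exp u *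
      Real.exp (-((a ^ 2 + ‖(2 * Real.pi) • ξ‖ ^ 2) * Real.exp u))) : ℝ) : ℂ) := fun u => by
    have h1 : ∀ x, e x * (F x u : ℂ) = ((Real.exp (-(a ^ 2 * Real.exp u)) : ℝ) : ℂ) *
        (e x * ((Real.exp (-(Real.exp (-u) / 4) * ‖x‖ ^ 2) : ℝ) : ℂ)) := fun x => by
      have : F x u = Real.exp (-(a ^ 2 * Real.exp u)) *
          Real.exp (-(Real.exp (-u) / 4) * ‖x‖ ^ 2) := by
        rw [← Real.exp_add]; simp only [F]; ring_nf
      rw [this, Complex.ofReal_mul]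
      ring
    have h2 := fourier_gaussian_plane u ξ
    rw [Real.fourier_eq] at h2
    simp only [h1, integral_const_mul]
    rw [show (∫ x, e x * ((Real.exp (-(Real.exp (-u) / 4) * ‖x‖ ^ 2) : ℝ) : ℂ)) = _ from h2,
      ← Complex.ofReal_mul, add_mul, neg_add, Real.exp_add]
    congr 1
    ring
  calc 𝓕 (fun x => (screenedKernel a x : ℂ)) ξ
      = ∫ x, (((4 * Real.pi)⁻¹ : ℝ) : ℂ) * ∫ u, e x * (F x u : ℂ) := by
        rw [Real.fourier_eq]
        refine integral_congr_ae (.of_forall fun x => ?_)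
        simp only [integral_const_mul, integral_complex_ofReal]
        change e x * ((screenedKernel a x : ℝ) : ℂ) = _
        rw [screenedKernel, Complex.ofReal_mul]
        simp only [F]
        ring
    _ = _ := by
        rw [integral_const_mul, integral_integral_swap hF]
        simp only [inner_int]
        rw [integral_complex_ofReal, integral_const_mul, integral_exp_mul_exp_neg_mul_exp hA,
          ← Complex.ofReal_mul]
        congr 1
        field_simp

/-! ### Passage to the stated constants -/

lemma normOne_pos {x : Plane} (hx : x ≠ 0) : 0 < normOne x := by
  by_contra! h
  have h0 := abs_nonneg (x 0)
  have h1 := abs_nonneg (x 1)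
  unfold normOne at h
  have e0 : x 0 = 0 := abs_eq_zero.1 (by linarith)
  have e1 : x 1 = 0 := abs_eq_zero.1 (by linarith)
  exact hx (PiLp.ext (Fin.forall_fin_two.2 ⟨e0, e1⟩))

lemma normOne_le (x : Plane) : normOne x ≤ 2 * ‖x‖ := by
  have h0 := PiLp.norm_apply_le x 0
  have h1 := PiLp.norm_apply_le x 1
  simp only [Real.norm_eq_abs] at h0 h1
  unfold normOne
  linarith

lemma norm_le_normOne (x : Plane) : ‖x‖ ≤ normOne x := by
  rw [EuclideanSpace.norm_eq, Fin.sum_univ_two, Real.sqrt_le_left (by unfold normOne; positivity)]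
  simp only [Real.norm_eq_abs, normOne]
  nlinarith [mul_nonneg (abs_nonneg (x 0)) (abs_nonneg (x 1))]

lemma screenedKernel_le_normOne {a : ℝ} (ha : 0 < a) {x : Plane} (hx : x ≠ 0) :
    screenedKernel a x ≤
      2 * Real.exp (5 / 4) * (2 / a) ^ (1 / 4 : ℝ) *
        (Real.exp (-(a * ‖x‖)) / normOne x ^ (1 / 4 : ℝ)) := by
  have hx' : 0 < ‖x‖ := norm_pos_iff.2 hx
  have hn := normOne_pos hx
  have hpow : (a * ‖x‖) ^ (-(1 / 4) : ℝ) ≤ (2 / a) ^ (1 / 4 : ℝ) / normOne x ^ (1 / 4 : ℝ) := by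
    rw [← Real.div_rpow (by positivity) hn.le, Real.rpow_neg (by positivity),
      ← Real.inv_rpow (by positivity)]
    refine Real.rpow_le_rpow (by positivity) ?_ (by norm_num)
    rw [inv_eq_one_div, div_div, div_le_div_iff₀ (by positivity) (by positivity)]
    nlinarith [normOne_le x]
  -- The factor 2e^{5/4} is pure slack; |x|₁ ≤ 2|x| already accounts for (2/a)^{1/4}.
  have he : 1 ≤ 2 * Real.exp (5 / 4) := by
    linarith [Real.one_le_exp (show (0 : ℝ) ≤ 5 / 4 by norm_num)]
  calc screenedKernel a x ≤ Real.exp (-(a * ‖x‖)) * (a * ‖x‖) ^ (-(1 / 4) : ℝ) :=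
        screenedKernel_le ha hx
    _ ≤ Real.exp (-(a * ‖x‖)) * ((2 / a) ^ (1 / 4 : ℝ) / normOne x ^ (1 / 4 : ℝ)) := by gcongr
    _ ≤ 2 * Real.exp (5 / 4) *
        (Real.exp (-(a * ‖x‖)) * ((2 / a) ^ (1 / 4 : ℝ) / normOne x ^ (1 / 4 : ℝ))) :=
        le_mul_of_one_le_left (by positivity) he
    _ = _ := by ring

lemma div_normOne_rpow_le {c : ℝ} (hc : 0 ≤ c) {x : Plane} (hx : x ≠ 0) :
    c / normOne x ^ (1 / 4 : ℝ) ≤ c / ‖x‖ ^ (1 / 4 : ℝ) := by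
  have := norm_pos_iff.2 hx
  have := norm_le_normOne x
  gcongr

lemma screenedKernel_le_C0f22 {lam2 : ℝ} (h2 : 0 < lam2) {x : Plane} (hx : x ≠ 0) :
    screenedKernel (a2 lam2) x ≤
      C0f22 lam2 * (Real.exp (-(a2 lam2 * ‖x‖)) / normOne x ^ (1 / 4 : ℝ)) := by
  have hn := normOne_pos hx
  exact (screenedKernel_le_normOne (Real.sqrt_pos.2 h2) hx).trans
    (mul_le_mul_of_nonneg_right (le_max_left _ _) (by positivity))

lemma mul_screenedKernel_le_C0f11 {lam1 : ℝ} (h1 : 0 < lam1) {x : Plane} (hx : x ≠ 0) :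
    a1 lam1 ^ 2 * screenedKernel (a1 lam1) x ≤
      C0f11 lam1 * (Real.exp (-(a1 lam1 * ‖x‖)) / normOne x ^ (1 / 4 : ℝ)) := by
  have hn := normOne_pos hx
  have ha : 0 < a1 lam1 := Real.sqrt_pos.2 (by positivity)
  calc _ ≤ a1 lam1 ^ 2 * (2 * Real.exp (5 / 4) * (2 / a1 lam1) ^ (1 / 4 : ℝ) *
        (Real.exp (-(a1 lam1 * ‖x‖)) / normOne x ^ (1 / 4 : ℝ))) :=
        mul_le_mul_of_nonneg_left (screenedKernel_le_normOne ha hx) (by positivity)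
    _ = a1 lam1 ^ 2 * (2 * Real.exp (5 / 4)) * (2 / a1 lam1) ^ (1 / 4 : ℝ) *
        (Real.exp (-(a1 lam1 * ‖x‖)) / normOne x ^ (1 / 4 : ℝ)) := by ring
    _ ≤ _ := mul_le_mul_of_nonneg_right (le_max_left _ _) (by positivity)

lemma fourier_const_mul_screenedKernel {a : ℝ} (ha : 0 < a) (c : ℝ) (ξ : Plane) :
    𝓕 (fun x => ((c * screenedKernel a x : ℝ) : ℂ)) ξ =
      ((c * (a ^ 2 + ‖(2 * Real.pi) • ξ‖ ^ 2)⁻¹ : ℝ) : ℂ) := by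
  have h := congrFun (VectorFourier.fourierIntegral_const_smul Real.fourierChar volume
    (innerₗ Plane) (fun x => (screenedKernel a x : ℂ)) (c : ℂ)) ξ
  rw [Complex.ofReal_mul, ← fourier_screenedKernel ha ξ]
  simp only [Complex.ofReal_mul]
  exact h

lemma fourier_sub_screenedKernel {a b : ℝ} (ha : 0 < a) (hb : 0 < b) (ξ : Plane) :
    𝓕 (fun x => ((screenedKernel a x - screenedKernel b x : ℝ) : ℂ)) ξ =
      (((a ^ 2 + ‖(2 * Real.pi) • ξ‖ ^ 2)⁻¹ - (b ^ 2 + ‖(2 * Real.pi) • ξ‖ ^ 2)⁻¹ : ℝ) : ℂ) := by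
  have i₁ : Integrable fun x => (screenedKernel a x : ℂ) := (integrable_screenedKernel ha).ofReal
  have i₂ : Integrable fun x => ((-1 * screenedKernel b x : ℝ) : ℂ) :=
    ((integrable_screenedKernel hb).const_mul (-1)).ofReal
  have h' : 𝓕 (fun x => ((screenedKernel a x + -1 * screenedKernel b x : ℝ) : ℂ)) ξ =
      𝓕 (fun x => (screenedKernel a x : ℂ)) ξ +
        𝓕 (fun x => ((-1 * screenedKernel b x : ℝ) : ℂ)) ξ := by
    simp only [Real.fourier_eq, Complex.ofReal_add, smul_add]
    exact integral_add ((Real.fourierIntegral_convergent_iff ξ).2 i₁)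
      ((Real.fourierIntegral_convergent_iff ξ).2 i₂)
  rw [fourier_screenedKernel ha, fourier_const_mul_screenedKernel hb, ← Complex.ofReal_add] at h'
  simpa only [neg_one_mul, ← sub_eq_add_neg] using h'

theorem mainTheorem11 (lam1 lam2 : ℝ) (h1 : 0 < lam1) (h2 : 0 < lam2) :
    ∃ g11 g22 g3 : Plane → ℂ,
      IsContinuousVersion (f11 h1) g11 ∧
      IsContinuousVersion (f22 h2) g22 ∧
      IsContinuousVersion (f3 h1 h2) g3 ∧
      ∀ x : Plane, x ≠ 0 →
        ‖g11 x‖ ≤ C0f11 lam1 * (Real.exp (-(a1 lam1 * ‖x‖)) / normOne x ^ (1 / 4 : ℝ)) ∧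
        ‖g22 x‖ ≤ C0f22 lam2 * (Real.exp (-(a2 lam2 * ‖x‖)) / normOne x ^ (1 / 4 : ℝ)) ∧
        (1 / lam1 ≥ lam2 →
          ‖g3 x‖ ≤ C0f22 lam2 * (Real.exp (-(a2 lam2 * ‖x‖)) / ‖x‖ ^ (1 / 4 : ℝ))) ∧
        (1 / lam1 ≤ lam2 →
          ‖g3 x‖ ≤ 1 / a1 lam1 ^ 2 * C0f11 lam1 *
            (Real.exp (-(a1 lam1 * ‖x‖)) / ‖x‖ ^ (1 / 4 : ℝ))) := by
  have ha₁ : 0 < a1 lam1 := Real.sqrt_pos.2 (by positivity)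
  have ha₂ : 0 < a2 lam2 := Real.sqrt_pos.2 h2
  have hs₁ : a1 lam1 ^ 2 = 1 / lam1 := Real.sq_sqrt (by positivity)
  have hs₂ : a2 lam2 ^ 2 = lam2 := Real.sq_sqrt h2.le
  have hc₁ := continuousOn_screenedKernel ha₁
  have hc₂ := continuousOn_screenedKernel ha₂
  have hd₁ : ∀ ξ : Plane, lam1 * ‖(2 * Real.pi) • ξ‖ ^ 2 + 1 ≠ 0 := fun ξ => by positivity
  have hd₂ : ∀ ξ : Plane, ‖(2 * Real.pi) • ξ‖ ^ 2 + lam2 ≠ 0 := fun ξ => by positivity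
  have hl₁ : ∀ ξ, l11 lam1 ξ = -(lam1 * ‖(2 * Real.pi) • ξ‖ ^ 2 + 1) := fun ξ => by
    rw [l11]; ring
  have hl₂ : ∀ ξ, l22 lam2 ξ = -(‖(2 * Real.pi) • ξ‖ ^ 2 + lam2) := fun ξ => by
    rw [l22]; ring
  have hi₁ : ∀ ξ : Plane, (a1 lam1 ^ 2 + ‖(2 * Real.pi) • ξ‖ ^ 2)⁻¹ =
      lam1 / (lam1 * ‖(2 * Real.pi) • ξ‖ ^ 2 + 1) := fun ξ => by
    rw [hs₁, inv_eq_one_div, div_eq_div_iff (by positivity) (hd₁ ξ)]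
    field_simp
    ring
  have hi₂ : ∀ ξ : Plane, (a2 lam2 ^ 2 + ‖(2 * Real.pi) • ξ‖ ^ 2)⁻¹ =
      1 / (‖(2 * Real.pi) • ξ‖ ^ 2 + lam2) := fun ξ => by
    rw [hs₂, inv_eq_one_div, add_comm]
  refine ⟨fun x => ((-a1 lam1 ^ 2 * screenedKernel (a1 lam1) x : ℝ) : ℂ),
    fun x => ((-1 * screenedKernel (a2 lam2) x : ℝ) : ℂ),
    fun x => ((screenedKernel (a1 lam1) x - screenedKernel (a2 lam2) x : ℝ) : ℂ),
    ⟨fourierInv_toLp_ae_eq _ ((integrable_screenedKernel ha₁).const_mul _).ofReal fun ξ => ?_,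
      Complex.continuous_ofReal.comp_continuousOn (continuousOn_const.mul hc₁)⟩,
    ⟨fourierInv_toLp_ae_eq _ ((integrable_screenedKernel ha₂).const_mul _).ofReal fun ξ => ?_,
      Complex.continuous_ofReal.comp_continuousOn (continuousOn_const.mul hc₂)⟩,
    ⟨fourierInv_toLp_ae_eq _ ((integrable_screenedKernel ha₁).sub
        (integrable_screenedKernel ha₂)).ofReal fun ξ => ?_,
      Complex.continuous_ofReal.comp_continuousOn (hc₁.sub hc₂)⟩,
    fun x hx => ?_⟩
  · rw [fourier_const_mul_screenedKernel ha₁, hi₁, hl₁, hs₁, one_div_neg_eq_neg_one_div]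
    field_simp
  · rw [fourier_const_mul_screenedKernel ha₂, hi₂, hl₂, one_div_neg_eq_neg_one_div, neg_one_mul]
  · rw [fourier_sub_screenedKernel ha₁ ha₂, hi₁, hi₂, hl₁, hl₂, l21, neg_mul_neg,
      div_sub_div _ _ (hd₁ ξ) (hd₂ ξ)]
    congr 2
    ring
  have hk₁ := screenedKernel_nonneg (a1 lam1) x
  have hk₂ := screenedKernel_nonneg (a2 lam2) x
  have hb₁ := mul_screenedKernel_le_C0f11 h1 hx
  have hb₂ := screenedKernel_le_C0f22 h2 hx
  simp only [Complex.norm_real, Real.norm_eq_abs]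
  refine ⟨?_, ?_, fun h => ?_, fun h => ?_⟩
  · rwa [neg_mul, abs_neg, abs_of_nonneg (by positivity)]
  · rwa [neg_one_mul, abs_neg, abs_of_nonneg hk₂]
  · have hle : a2 lam2 ≤ a1 lam1 := Real.sqrt_le_sqrt h
    have hanti := screenedKernel_anti ha₂ hle hx
    -- The second entry of the maximum serves only to show that the constant is nonnegative.
    have hC : 0 ≤ C0f22 lam2 := (Real.sqrt_nonneg _).trans (le_max_right _ _)
    -- For 0 ≤ s ≤ t, |s - t| ≤ t: the slower-decaying kernel dominates the difference.
    calc _ ≤ screenedKernel (a2 lam2) x := by rw [abs_le]; constructor <;> linarith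
      _ ≤ _ := hb₂.trans
        (mul_le_mul_of_nonneg_left (div_normOne_rpow_le (Real.exp_pos _).le hx) hC)
  · have hle : a1 lam1 ≤ a2 lam2 := Real.sqrt_le_sqrt h
    have hanti := screenedKernel_anti ha₁ hle hx
    have hC : 0 ≤ C0f11 lam1 := le_trans (by positivity) (le_max_right _ _)
    calc _ ≤ screenedKernel (a1 lam1) x := by rw [abs_le]; constructor <;> linarith
      _ = 1 / a1 lam1 ^ 2 * (a1 lam1 ^ 2 * screenedKernel (a1 lam1) x) := by field_simp
      _ ≤ 1 / a1 lam1 ^ 2 * (C0f11 lam1 * (Real.exp (-(a1 lam1 * ‖x‖)) / ‖x‖ ^ (1 / 4 : ℝ))) :=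
        mul_le_mul_of_nonneg_left (hb₁.trans
          (mul_le_mul_of_nonneg_left (div_normOne_rpow_le (Real.exp_pos _).le hx) hC))
          (by positivity)
      _ = _ := by ring
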